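/- Let $\Omega\subset\mathbb R^2$ be a polygonal domain (the bounded domain enclosed by a simple closed polygon) with at most one interior angle greater than $\pi/2$. Let $\omega\in(0,2\pi)$ be its largest interior angle, attained at a vertex $Q$ which is placed at the origin, and let $(r,\theta)$ be polar coordinates such that near $Q$ the domain $\Omega$ is the sector $0<\theta<\omega$. Let $R>0$ be such that $K_\omega^R=\{(r,\theta): 0\le r\le R,\ 0\le\theta\le\omega\}\subset\overline\Omega$, let $\tau\in(0,1)$, and let $\eta=\eta(r)$ be a $C^\infty$ radial cut-off function with $\eta=1$ for $0\le r\le\tau R$ and $\eta=0$ for $r>R$. Let $N\ge 0$ be the largest integer with $N<2\omega/\pi$. For $i=1,\dots,N$ put $$\chi_i(r,\theta)=\eta(r)\,r^{-\frac{i\pi}{\omega}}\sin\Big(\frac{i\pi}{\omega}\theta\Big)\ \text{ in } K_\omega^R,\qquad \chi_i=0\ \text{ in } \Omega\setminus K_\omega^R,$$ let $\zeta_i\in H^1_0(\Omega)$ be the weak solution of $-\Delta\zeta_i=\Delta\chi_i$ in $\Omega$, $\zeta_i=0$ on $\partial\Omega$ (the right-hand side being the classical Laplacian of $\chi_i$ in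 $\Omega$), that is, $\int_\Omega\nabla\zeta_i\cdot\nabla v=\int_\Omega(\Delta\chi_i)\,v$ for all $v\in H^1_0(\Omega)$, and put $\xi_i=\chi_i+\zeta_i$. **Theorem.** (a) The functions $\xi_i$, $i=1,\dots,N$, belong to $H^{-1}(\Omega)=(H^1_0(\Omega))^*$ (that is, $\varphi\mapsto\int_\Omega\xi_i\varphi$, $\varphi\in C_c^\infty(\Omega)$, extends to a bounded linear functional on $H^1_0(\Omega)$), and they are linearly independent in $H^{-1}(\Omega)$. (b) Let $\sigma_i\in H^1_0(\Omega)$ be the weak solution of $-\Delta\sigma_i=\xi_i$ in $\Omega$, $\sigma_i=0$ on $\partial\Omega$, that is, $\int_\Omega\nabla\sigma_i\cdot\nabla v=\langle\xi_i,v\rangle$ for all $v\in H^1_0(\Omega)$. Then $\sigma_1,\dots,\sigma_N$ are linearly independent (as elements of $L^2(\Omega)$), and $\nabla\sigma_1,\dots,\nabla\sigma_N$ are linearly independent (in $L^2(\Omega;\mathbb R^2)$). -/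

import Mathlib

open MeasureTheory Set

noncomputable section

namespace CornerSingular

/-! The plane `ℝ²` is identified with `ℂ`, as a real inner product space with Lebesgue measure. -/

/-! ### Sectors, polygonal domains, interior angles -/

/-- The open sector with vertex `p`, radius `ρ` and opening `α`, whose first side has
direction `exp (β * I)`. -/
def openSector (p : ℂ) (β α ρ : ℝ) : Set ℂ :=
  {z | ∃ r ∈ Ioo (0 : ℝ) ρ, ∃ θ ∈ Ioo (0 : ℝ) α, z = p + r * Complex.exp ((β + θ : ℝ) * Complex.I)}

/-- The closed sector `{(r, θ) | 0 ≤ r ≤ R, 0 ≤ θ ≤ ω}` at the origin. -/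
def closedSector (ω R : ℝ) : Set ℂ :=
  {z | ∃ r ∈ Icc (0 : ℝ) R, ∃ θ ∈ Icc (0 : ℝ) ω, z = r * Complex.exp ((θ : ℝ) * Complex.I)}

/-- A simple closed polygon: at least three vertices, which are distinct, and two different edges
meet at most in a common vertex. -/
def IsSimplePolygon {n : ℕ} (P : Polygon ℂ n) : Prop :=
  3 ≤ n ∧ Function.Injective P.vertices ∧
    ∀ i j, i ≠ j → P.edgeSet ℝ i ∩ P.edgeSet ℝ j ⊆
      {P i, P (finRotate n i)} ∩ {P j, P (finRotate n j)}

/-- `Ω` is the polygonal domain enclosed by the simple closed polygon `P`: the bounded domain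
with boundary `P`. -/
structure IsPolygonalDomain {n : ℕ} (P : Polygon ℂ n) (Ω : Set ℂ) : Prop where
  simple : IsSimplePolygon P
  isOpen : IsOpen Ω
  isConnected : IsConnected Ω
  isBounded : Bornology.IsBounded Ω
  frontier_eq : frontier Ω = P.boundary ℝ

/-- `α ∈ (0, 2π)` is the interior angle of `Ω` at `p`, the first side having direction
`exp (β * I)`: near `p` the set `Ω` is a sector of opening `α`. -/
def IsInteriorAngleFrom (Ω : Set ℂ) (p : ℂ) (β α : ℝ) : Prop :=
  0 < α ∧ α < 2 * Real.pi ∧ ∃ ρ > 0, Ω ∩ Metric.ball p ρ = openSector p β α ρ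

/-- `α` is the interior angle of `Ω` at `p`. -/
def IsInteriorAngle (Ω : Set ℂ) (p : ℂ) (α : ℝ) : Prop :=
  ∃ β, IsInteriorAngleFrom Ω p β α

/-! ### Sobolev spaces -/

/-- `φ ∈ C_c^∞(Ω)`. -/
def IsTest (Ω : Set ℂ) (φ : ℂ → ℝ) : Prop :=
  ContDiff ℝ (⊤ : ℕ∞) φ ∧ HasCompactSupport φ ∧ tsupport φ ⊆ Ω

/-- The Hilbert space `L²(Ω) × L²(Ω; ℝ²)`, with norm `(‖u‖² + ‖g‖²)^(1/2)`. -/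
abbrev JetL2 (Ω : Set ℂ) : Type :=
  WithLp 2 (Lp ℝ 2 (volume.restrict Ω) × Lp ℂ 2 (volume.restrict Ω))

/-- `p = (φ, ∇φ)` as an element of `L²(Ω) × L²(Ω; ℝ²)`. -/
def IsJetOf {Ω : Set ℂ} (p : JetL2 Ω) (φ : ℂ → ℝ) : Prop :=
  p.fst =ᵐ[volume.restrict Ω] φ ∧ p.snd =ᵐ[volume.restrict Ω] fun x => gradient φ x

/-- `H¹₀(Ω)`: the closure of `C_c^∞(Ω)` in the `H¹` norm. An element is a pair `(u, ∇u)`. -/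
def H10 (Ω : Set ℂ) : Submodule ℝ (JetL2 Ω) :=
  (Submodule.span ℝ {p | ∃ φ, IsTest Ω φ ∧ IsJetOf p φ}).topologicalClosure

/-- The function `u ∈ L²(Ω)` underlying an element of `H¹₀(Ω)`. -/
def toL2 {Ω : Set ℂ} (u : H10 Ω) : Lp ℝ 2 (volume.restrict Ω) := (u : JetL2 Ω).fst

/-- The gradient `∇u ∈ L²(Ω; ℝ²)` of an element of `H¹₀(Ω)`. -/
def grad {Ω : Set ℂ} (u : H10 Ω) : Lp ℂ 2 (volume.restrict Ω) := (u : JetL2 Ω).snd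

/-- `H⁻¹(Ω)`, the dual space of `H¹₀(Ω)`. -/
abbrev HNegOne (Ω : Set ℂ) : Type := StrongDual ℝ (H10 Ω)

/-- `F ∈ H⁻¹(Ω)` is the function `f`: `⟨F, φ⟩ = ∫_Ω f φ` for every `φ ∈ C_c^∞(Ω)`. -/
def HNegOne.IsFunction {Ω : Set ℂ} (F : HNegOne Ω) (f : ℂ → ℝ) : Prop :=
  ∀ (φ : ℂ → ℝ) (v : H10 Ω), IsTest Ω φ → IsJetOf (v : JetL2 Ω) φ →
    IntegrableOn (fun x => f x * φ x) Ω ∧ F v = ∫ x in Ω, f x * φ x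

/-- The Dirichlet form `A(u, v) = ∫_Ω ∇u · ∇v`. -/
def dirichletForm {Ω : Set ℂ} (u v : H10 Ω) : ℝ :=
  ∫ x in Ω, inner ℝ (grad u x) (grad v x)

/-- `u ∈ H¹₀(Ω)` is the weak solution of `-Δu = f` in `Ω`, `u = 0` on `∂Ω`, where `f` is a
function on `Ω`. -/
def IsWeakSolutionFun {Ω : Set ℂ} (u : H10 Ω) (f : ℂ → ℝ) : Prop :=
  ∀ v : H10 Ω, dirichletForm u v = ∫ x in Ω, f x * toL2 v x

/-- `u ∈ H¹₀(Ω)` is the weak solution of `-Δu = F` in `Ω`, `u = 0` on `∂Ω`, where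
`F ∈ H⁻¹(Ω)`. -/
def IsWeakSolution {Ω : Set ℂ} (u : H10 Ω) (F : HNegOne Ω) : Prop :=
  ∀ v : H10 Ω, dirichletForm u v = F v

/-! ### The corner singular functions -/

/-- The polar angle in `[0, 2π)`. -/
def polarAngle (z : ℂ) : ℝ := toIcoMod Real.two_pi_pos 0 z.arg

/-- `η` is a smooth radial cut-off: `η = 1` on `[0, τ R]` and `η = 0` on `(R, ∞)`. -/
def IsCutoff (η : ℝ → ℝ) (τ R : ℝ) : Prop :=
  ContDiff ℝ (⊤ : ℕ∞) η ∧ (∀ r, 0 ≤ r → r ≤ τ * R → η r = 1) ∧ ∀ r, R < r → η r = 0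

open Classical in
/-- The cut-off singular function `χ_k = η(r) r^(-kπ/ω) sin (kπθ/ω)` on the sector of opening `ω`
and radius `R`, and `0` outside that sector. -/
def chi (η : ℝ → ℝ) (ω R : ℝ) (k : ℕ) (z : ℂ) : ℝ :=
  if z ∈ closedSector ω R then
    η ‖z‖ * ‖z‖ ^ (-(k * Real.pi / ω)) * Real.sin (k * Real.pi / ω * polarAngle z)
  else 0

end CornerSingular

end

noncomputable section

namespace CornerSingular

open Filter Topology
open scoped ENNReal NNReal

variable {Ω : Set ℂ}

/-! ### Test functions and the space `H¹₀(Ω)` -/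

/-! Everything rests on a gap in integrability at the corner. In the plane `H¹₀(Ω)` embeds in
`Lᵠ(Ω)` for every finite `q` (`exists_eLpNorm_toL2_le`). By duality every `Lᵖ(Ω)` with `p > 1` lies
in `H⁻¹(Ω)` (`exists_functional`). Since `iπ/ω < 2` for `i ≤ N`, the function `χ_i` is in `Lᵖ` for
some `p > 1`, so `ξ_i = χ_i + ζ_i` is in `H⁻¹(Ω)`.

If `∑ c_i ξ_i = 0` in `H⁻¹(Ω)`, the fundamental lemma of the calculus of variations gives `∑ c_i χ_i
= -∑ c_i ζ_i` almost everywhere, and the right side is in every `Lᵠ`. If some coefficient is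
nonzero, let `k` be the largest index with `c_k ≠ 0`. Near the corner the left side is of size
`r^(-kπ/ω)` along a suitable ray, so it just fails to be in `Lᵠ` at the critical exponent `q =
2ω/(kπ)`. Hence all `c_i` vanish (`eq_zero_of_memLp_sum_chi`).

For the `σ_i`, a combination with zero gradient has zero Dirichlet form against every `v`, so the
same combination of the `ξ_i` vanishes. A combination that is zero as a function also has zero
gradient, because the gradient component is a weak gradient (`grad_eq_zero_of_toL2_eq_zero`). -/

lemma norm_gradient_eq_norm_fderiv (φ : ℂ → ℝ) (x : ℂ) : ‖gradient φ x‖ = ‖fderiv ℝ φ x‖ := by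
  simp [gradient]

lemma inner_gradient_left {φ : ℂ → ℝ} (x v : ℂ) : inner ℝ (gradient φ x) v = fderiv ℝ φ x v := by
  simp [gradient]

lemma IsTest.continuous_gradient {φ : ℂ → ℝ} (h : IsTest Ω φ) :
    Continuous (fun x => gradient φ x) :=
  (InnerProductSpace.toDual ℝ ℂ).symm.continuous.comp (h.1.continuous_fderiv (by simp))

lemma IsTest.hasCompactSupport_gradient {φ : ℂ → ℝ} (h : IsTest Ω φ) :
    HasCompactSupport (fun x => gradient φ x) :=
  (h.2.1.fderiv (𝕜 := ℝ)).comp_left (g := (InnerProductSpace.toDual ℝ ℂ).symm) (map_zero _)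

lemma IsTest.memLp {φ : ℂ → ℝ} (h : IsTest Ω φ) (p : ℝ≥0∞) : MemLp φ p (volume.restrict Ω) :=
  (h.1.continuous.memLp_of_hasCompactSupport h.2.1).restrict Ω

lemma IsTest.memLp_gradient {φ : ℂ → ℝ} (h : IsTest Ω φ) (p : ℝ≥0∞) :
    MemLp (fun x => gradient φ x) p (volume.restrict Ω) :=
  (h.continuous_gradient.memLp_of_hasCompactSupport h.hasCompactSupport_gradient).restrict Ω

/-- A test function is the first component of an element of `H¹₀(Ω)`. -/
lemma IsTest.exists_jet {φ : ℂ → ℝ} (h : IsTest Ω φ) :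
    ∃ v : H10 Ω, IsJetOf (v : JetL2 Ω) φ := by
  let p : JetL2 Ω := WithLp.toLp 2 ((h.memLp 2).toLp φ, (h.memLp_gradient 2).toLp _)
  have hp : IsJetOf p φ := ⟨(h.memLp 2).coeFn_toLp, (h.memLp_gradient 2).coeFn_toLp⟩
  exact ⟨⟨p, Submodule.le_topologicalClosure _ (Submodule.subset_span ⟨φ, h, hp⟩)⟩, hp⟩

lemma IsTest.zero : IsTest Ω (fun _ => 0) :=
  ⟨contDiff_const, HasCompactSupport.zero, by simp [tsupport, Function.support]⟩

lemma IsTest.add {φ ψ : ℂ → ℝ} (h : IsTest Ω φ) (k : IsTest Ω ψ) :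
    IsTest Ω (fun x => φ x + ψ x) :=
  ⟨h.1.add k.1, h.2.1.add k.2.1, (tsupport_add φ ψ).trans (union_subset h.2.2 k.2.2)⟩

lemma IsTest.const_mul {φ : ℂ → ℝ} (h : IsTest Ω φ) (c : ℝ) : IsTest Ω (fun x => c * φ x) :=
  ⟨contDiff_const.mul h.1, h.2.1.mul_left,
    (closure_mono fun _ hx => right_ne_zero_of_mul hx).trans h.2.2⟩

lemma IsTest.differentiable {φ : ℂ → ℝ} (h : IsTest Ω φ) : Differentiable ℝ φ :=
  h.1.differentiable (by simp)

lemma IsJetOf.add {p q : JetL2 Ω} {φ ψ : ℂ → ℝ} (hp : IsJetOf p φ) (hq : IsJetOf q ψ)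
    (h : IsTest Ω φ) (k : IsTest Ω ψ) : IsJetOf (p + q) (fun x => φ x + ψ x) := by
  constructor
  · filter_upwards [Lp.coeFn_add p.fst q.fst, hp.1, hq.1] with x h1 h2 h3
    rw [WithLp.add_fst, h1, Pi.add_apply, h2, h3]
  · filter_upwards [Lp.coeFn_add p.snd q.snd, hp.2, hq.2] with x h1 h2 h3
    rw [WithLp.add_snd, h1, Pi.add_apply, h2, h3, gradient, gradient, gradient,
      fderiv_fun_add (h.differentiable x) (k.differentiable x), map_add]

lemma IsJetOf.smul {p : JetL2 Ω} {φ : ℂ → ℝ} (hp : IsJetOf p φ) (h : IsTest Ω φ) (c : ℝ) :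
    IsJetOf (c • p) (fun x => c * φ x) := by
  constructor
  · filter_upwards [Lp.coeFn_smul c p.fst, hp.1] with x h1 h2
    rw [WithLp.smul_fst, h1, Pi.smul_apply, h2, smul_eq_mul]
  · filter_upwards [Lp.coeFn_smul c p.snd, hp.2] with x h1 h2
    rw [WithLp.smul_snd, h1, Pi.smul_apply, h2, gradient, gradient,
      fderiv_const_mul (h.differentiable x), map_smulₛₗ]
    simp

lemma IsJetOf.zero : IsJetOf (0 : JetL2 Ω) (fun _ => 0) := by
  constructor
  · exact Lp.coeFn_zero _ _ _
  · filter_upwards [Lp.coeFn_zero ℂ 2 (volume.restrict Ω)] with x h1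
    rw [WithLp.zero_snd, h1]
    simp [gradient]

/-- `H¹₀(Ω)` is the closure of the set of jets of test functions. -/
lemma mem_closure_jets (u : H10 Ω) :
    (u : JetL2 Ω) ∈ closure {p : JetL2 Ω | ∃ φ, IsTest Ω φ ∧ IsJetOf p φ} := by
  -- The jets of test functions already form a subspace, so taking the span in the definition of
  -- `H10` adds nothing.
  let S : Submodule ℝ (JetL2 Ω) :=
    { carrier := {p | ∃ φ, IsTest Ω φ ∧ IsJetOf p φ}
      add_mem' := by
        rintro a b ⟨φ, h, ha⟩ ⟨ψ, k, hb⟩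
        exact ⟨_, h.add k, ha.add hb h k⟩
      zero_mem' := ⟨_, IsTest.zero, IsJetOf.zero⟩
      smul_mem' := by
        rintro c a ⟨φ, h, ha⟩
        exact ⟨_, h.const_mul c, ha.smul h c⟩ }
  have h : (u : JetL2 Ω) ∈ (Submodule.span ℝ (S : Set (JetL2 Ω))).topologicalClosure := u.2
  rwa [Submodule.span_eq] at h

/-- A closed property that holds for the jets of test functions holds on `H¹₀(Ω)`. -/
lemma H10.induction {C : Set (JetL2 Ω)} (hC : IsClosed C)
    (h : ∀ φ p, IsTest Ω φ → IsJetOf p φ → p ∈ C) (u : H10 Ω) : (u : JetL2 Ω) ∈ C :=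
  closure_minimal (by rintro p ⟨φ, h1, h2⟩; exact h φ p h1 h2) hC (mem_closure_jets u)

lemma norm_snd_le (p : JetL2 Ω) : ‖p.snd‖ ≤ ‖p‖ := WithLp.norm_snd_le _ p

/-! ### The Sobolev inequality -/

/-- A lower semicontinuity property of `Lᵠ` norms under `L²` convergence. -/
lemma isClosed_eLpNorm_le (q : ℝ≥0∞) (C : ℝ≥0∞) (hC : C ≠ ∞) :
    IsClosed {p : JetL2 Ω | eLpNorm p.fst q (volume.restrict Ω) ≤ C * ENNReal.ofReal ‖p‖} := by
  refine IsSeqClosed.isClosed fun p l hp hl => ?_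
  have hfst : Tendsto (fun n => (p n).fst) atTop (𝓝 l.fst) :=
    ((WithLp.fstL 2 ℝ _ _ : JetL2 Ω →L[ℝ] _).continuous.tendsto l).comp hl
  -- `L²` convergence gives an almost everywhere convergent subsequence, to which Fatou's lemma
  -- applies.
  obtain ⟨ns, hns, hae⟩ := (tendstoInMeasure_of_tendsto_Lp hfst).exists_seq_tendsto_ae
  have hle := Lp.eLpNorm_lim_le_liminf_eLpNorm (p := q)
    (fun n => (Lp.aestronglyMeasurable (p (ns n)).fst)) _ hae
  have hlim : Tendsto (fun n => C * ENNReal.ofReal ‖p (ns n)‖) atTop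
      (𝓝 (C * ENNReal.ofReal ‖l‖)) :=
    ENNReal.Tendsto.const_mul
      ((ENNReal.continuous_ofReal.tendsto _).comp ((hl.comp hns.tendsto_atTop).norm)) (Or.inr hC)
  refine hle.trans ?_
  rw [← hlim.liminf_eq]
  exact liminf_le_liminf (Eventually.of_forall fun n => hp (ns n))

/-- Gagliardo–Nirenberg–Sobolev is applied with a gradient exponent `r < 2`, below the borderline of
dimension two. Hölder's inequality on the bounded set `Ω` then replaces `r` by `2`, at the cost of
the factor `|Ω|^(1/r - 1/2)`. -/
lemma IsTest.eLpNorm_le {q : ℝ≥0} (hq : 1 ≤ q) (hb : Bornology.IsBounded Ω) :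
    ∃ C : ℝ≥0, ∀ φ, IsTest Ω φ → eLpNorm φ q (volume.restrict Ω) ≤
      C * eLpNorm (fun x => gradient φ x) 2 (volume.restrict Ω) := by
  obtain ⟨r, hr1, hr2, hrq⟩ : ∃ r : ℝ≥0, 1 ≤ r ∧ r < 2 ∧ (r : ℝ)⁻¹ - 2⁻¹ ≤ (q : ℝ)⁻¹ := by
    have hq' : (1 : ℝ) ≤ q := hq
    -- This `r` satisfies `1/r - 1/2 = 1/(2q)`: its Sobolev conjugate is `2q`, which exceeds `q`.
    refine ⟨2 * q / (q + 1), ?_, ?_, ?_⟩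
    · rw [one_le_div (by positivity), two_mul]; gcongr
    · rw [div_lt_iff₀ (by positivity), mul_add]; simp
    · push_cast
      have : (0 : ℝ) < q := by linarith
      rw [inv_div]
      field_simp
      linarith
  let K := eLpNormLESNormFDerivOfLeConst ℝ (volume : Measure ℂ) Ω r q
  let m : ℝ≥0∞ := volume.restrict Ω univ ^ (1 / (r : ℝ≥0∞).toReal - 1 / (2 : ℝ≥0∞).toReal)
  have hm : m ≠ ∞ := by
    refine ENNReal.rpow_ne_top_of_nonneg ?_ ?_
    · have : (r : ℝ) < 2 := hr2
      have h0 : (0 : ℝ) < r := lt_of_lt_of_le one_pos hr1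
      simp only [ENNReal.coe_toReal, ENNReal.toReal_ofNat, sub_nonneg]
      gcongr
    · simpa using hb.measure_lt_top.ne
  refine ⟨K * m.toNNReal, fun φ h => ?_⟩
  have hsupp : φ.support ⊆ Ω := (subset_tsupport _).trans h.2.2
  have hφ : ContDiff ℝ 1 φ := h.1.of_le (by exact_mod_cast le_top)
  have hfin : r < Module.finrank ℝ ℂ := by rw [Complex.finrank_real_complex]; exact_mod_cast hr2
  have hfin' : (r : ℝ)⁻¹ - (Module.finrank ℝ ℂ : ℝ)⁻¹ ≤ (q : ℝ)⁻¹ := by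
    rw [Complex.finrank_real_complex]; exact_mod_cast hrq
  have h1 := eLpNorm_le_eLpNorm_fderiv_of_le volume hφ hsupp hr1 hfin hfin' hb
  have h2 : eLpNorm (fderiv ℝ φ) r volume = eLpNorm (fun x => gradient φ x) r volume :=
    eLpNorm_congr_norm_ae (Eventually.of_forall fun x => (norm_gradient_eq_norm_fderiv φ x).symm)
  have h3 : eLpNorm (fun x => gradient φ x) r (volume.restrict Ω) =
      eLpNorm (fun x => gradient φ x) r volume := by
    refine eLpNorm_restrict_eq_of_support_subset fun x hx => ?_
    refine h.2.2 (support_fderiv_subset ℝ (f := φ) ?_)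
    rw [Function.mem_support, ← norm_ne_zero_iff] at hx ⊢
    rwa [norm_gradient_eq_norm_fderiv] at hx
  have h4 := eLpNorm_le_eLpNorm_mul_rpow_measure_univ (p := r) (q := 2)
    (by exact_mod_cast hr2.le) (h.memLp_gradient (Ω := Ω) 2).1
  calc eLpNorm φ q (volume.restrict Ω) ≤ eLpNorm φ q volume :=
        eLpNorm_mono_measure _ Measure.restrict_le_self
    _ ≤ K * (eLpNorm (fun x => gradient φ x) 2 (volume.restrict Ω) * m) := by
        refine h1.trans ?_
        rw [h2, ← h3]
        gcongr
    _ = _ := by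
        rw [ENNReal.coe_mul, ENNReal.coe_toNNReal hm]; ring

/-- The embedding `H¹₀(Ω) ⊂ Lᵠ(Ω)` for `q < ∞`, in the plane. -/
lemma exists_eLpNorm_toL2_le {q : ℝ≥0} (hq : 1 ≤ q) (hb : Bornology.IsBounded Ω) :
    ∃ C : ℝ≥0, ∀ u : H10 Ω,
      eLpNorm (toL2 u) q (volume.restrict Ω) ≤ C * ENNReal.ofReal ‖u‖ := by
  obtain ⟨C, hC⟩ := IsTest.eLpNorm_le hq hb
  refine ⟨C, fun u => ?_⟩
  refine H10.induction (isClosed_eLpNorm_le q C ENNReal.coe_ne_top) (fun φ p h hp => ?_) u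
  change eLpNorm p.fst q _ ≤ _
  rw [eLpNorm_congr_ae hp.1]
  refine (hC φ h).trans ?_
  rw [← eLpNorm_congr_ae hp.2, ← ENNReal.ofReal_toReal (Lp.eLpNorm_ne_top p.snd), ← Lp.norm_def]
  gcongr
  exact norm_snd_le p

lemma memLp_toL2 {q : ℝ≥0} (hq : 1 ≤ q) (hb : Bornology.IsBounded Ω) (u : H10 Ω) :
    MemLp (toL2 u) q (volume.restrict Ω) := by
  obtain ⟨C, hC⟩ := exists_eLpNorm_toL2_le hq hb
  exact ⟨Lp.aestronglyMeasurable _,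
    (hC u).trans_lt (ENNReal.mul_lt_top ENNReal.coe_lt_top ENNReal.ofReal_lt_top)⟩

/-! ### Functions as elements of `H⁻¹(Ω)` -/

/-- On a bounded plane domain, `Lᵖ(Ω) ⊂ H⁻¹(Ω)` for `p > 1`. -/
lemma exists_functional {p : ℝ≥0} (hp : 1 < p) (hb : Bornology.IsBounded Ω) {f : ℂ → ℝ}
    (hf : MemLp f p (volume.restrict Ω)) :
    ∃ F : HNegOne Ω, ∀ v : H10 Ω, IntegrableOn (fun x => f x * toL2 v x) Ω ∧
      F v = ∫ x in Ω, f x * toL2 v x := by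
  have hpq : p.HolderConjugate (p.conjExponent) := .conjExponent hp
  have hq : 1 ≤ p.conjExponent := hpq.symm.lt.le
  have : ENNReal.HolderConjugate p (p.conjExponent : ℝ≥0) := hpq.coe_ennreal
  have hint : ∀ v : H10 Ω, IntegrableOn (fun x => f x * toL2 v x) Ω := fun v =>
    hf.integrable_mul (memLp_toL2 hq hb v)
  obtain ⟨C, hC⟩ := exists_eLpNorm_toL2_le hq hb
  let L : H10 Ω →ₗ[ℝ] ℝ :=
    { toFun := fun v => ∫ x in Ω, f x * toL2 v x
      map_add' := fun v w => by
        rw [← integral_add (hint v) (hint w)]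
        refine integral_congr_ae ?_
        filter_upwards [Lp.coeFn_add (toL2 v) (toL2 w)] with x hx
        change f x * (toL2 v + toL2 w) x = _
        rw [hx, Pi.add_apply, mul_add]
      map_smul' := fun c v => by
        rw [RingHom.id_apply, smul_eq_mul, ← integral_const_mul]
        refine integral_congr_ae ?_
        filter_upwards [Lp.coeFn_smul c (toL2 v)] with x hx
        change f x * (c • toL2 v) x = _
        rw [hx, Pi.smul_apply, smul_eq_mul]
        ring }
  refine ⟨L.mkContinuous ((eLpNorm f p (volume.restrict Ω)).toReal * C) fun v => ?_,
    fun v => ⟨hint v, rfl⟩⟩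
  change ‖∫ x in Ω, f x * toL2 v x‖ ≤ _
  have h1 : eLpNorm (f • (toL2 v : ℂ → ℝ)) 1 (volume.restrict Ω) ≤
      eLpNorm f p (volume.restrict Ω) * (C * ENNReal.ofReal ‖v‖) :=
    (eLpNorm_smul_le_mul_eLpNorm (memLp_toL2 hq hb v).1 hf.1).trans (by gcongr; exact hC v)
  have h2 := ENNReal.toReal_mono
    (ENNReal.mul_ne_top hf.2.ne (ENNReal.mul_ne_top ENNReal.coe_ne_top ENNReal.ofReal_ne_top)) h1
  rw [ENNReal.toReal_mul, ENNReal.toReal_mul, ENNReal.coe_toReal,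
    ENNReal.toReal_ofReal (norm_nonneg _), ← mul_assoc] at h2
  refine le_trans ?_ h2
  refine (norm_integral_le_lintegral_norm _).trans (le_of_eq ?_)
  rw [eLpNorm_one_eq_lintegral_enorm]
  refine congrArg ENNReal.toReal (lintegral_congr fun x => ?_)
  rw [ofReal_norm]
  rfl

lemma HNegOne.isFunction_of_forall {F : HNegOne Ω} {f : ℂ → ℝ}
    (h : ∀ v : H10 Ω, IntegrableOn (fun x => f x * toL2 v x) Ω ∧
      F v = ∫ x in Ω, f x * toL2 v x) : F.IsFunction f := by
  intro φ v _ hv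
  have hae : (fun x => f x * toL2 v x) =ᵐ[volume.restrict Ω] fun x => f x * φ x := by
    filter_upwards [hv.1] with x hx
    change f x * (v : JetL2 Ω).fst x = _
    rw [hx]
  exact ⟨(h v).1.congr hae, (h v).2.trans (integral_congr_ae hae)⟩

/-- The zero functional is represented only by the zero function. -/
lemma HNegOne.IsFunction.ae_eq_zero {f : ℂ → ℝ} (hΩ : IsOpen Ω)
    (h : HNegOne.IsFunction (0 : HNegOne Ω) f) (hf : LocallyIntegrableOn f Ω) :
    f =ᵐ[volume.restrict Ω] 0 := by
  rw [EventuallyEq, ae_restrict_iff' hΩ.measurableSet]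
  refine hΩ.ae_eq_zero_of_integral_contDiff_smul_eq_zero hf fun g hg hgc hgs => ?_
  have hgt : IsTest Ω g := ⟨hg, hgc, hgs⟩
  obtain ⟨v, hv⟩ := hgt.exists_jet
  have h1 := (h g v hgt hv).2
  rw [← setIntegral_eq_integral_of_forall_compl_eq_zero (s := Ω)]
  · simpa [mul_comm] using h1.symm
  · intro x hx
    rw [image_eq_zero_of_notMem_tsupport fun h' => hx (hgs h'), zero_smul]

lemma HNegOne.IsFunction.sum {ι : Type*} (s : Finset ι) {F : ι → HNegOne Ω} {f : ι → ℂ → ℝ}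
    (h : ∀ i, (F i).IsFunction (f i)) (c : ι → ℝ) :
    (∑ i ∈ s, c i • F i).IsFunction (fun x => ∑ i ∈ s, c i * f i x) := by
  intro φ v hφ hv
  have hi : ∀ i ∈ s, IntegrableOn (fun x => c i * (f i x * φ x)) Ω := fun i _ =>
    (h i φ v hφ hv).1.const_mul (c i)
  simp only [Finset.sum_mul, mul_assoc]
  refine ⟨integrable_finsetSum _ hi, ?_⟩
  rw [integral_finsetSum _ hi, sum_apply]
  refine Finset.sum_congr rfl fun i _ => ?_
  rw [integral_const_mul, smul_apply, (h i φ v hφ hv).2, smul_eq_mul]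

/-! ### The gradient of an element of `H¹₀(Ω)` is a weak gradient -/

/-- For the jet of a test function this is integration by parts. Both sides are `L²` inner products
with fixed functions, so the identity is a closed condition and passes to all of `H¹₀(Ω)`. -/
lemma IsTest.inner_grad_eq {ψ : ℂ → ℝ} (hψ : IsTest Ω ψ) (e : ℂ) (u : H10 Ω) :
    ∫ x in Ω, ψ x * inner ℝ e (grad u x) = - ∫ x in Ω, fderiv ℝ ψ x e * toL2 u x := by
  have hΨ : MemLp (fun x => ψ x • e) 2 (volume.restrict Ω) :=
    ((hψ.1.continuous.smul continuous_const).memLp_of_hasCompactSupport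
      hψ.2.1.smul_right).restrict Ω
  have hdc : Continuous fun x => fderiv ℝ ψ x e :=
    (hψ.1.continuous_fderiv (by simp)).clm_apply continuous_const
  have hD : MemLp (fun x => fderiv ℝ ψ x e) 2 (volume.restrict Ω) :=
    (hdc.memLp_of_hasCompactSupport (hψ.2.1.fderiv_apply (𝕜 := ℝ) e)).restrict Ω
  let C : Set (JetL2 Ω) := {p | inner ℝ (hΨ.toLp _) p.snd = - inner ℝ (hD.toLp _) p.fst}
  have hC : IsClosed C := isClosed_eq
    (continuous_const.inner (WithLp.sndL 2 ℝ _ _ : JetL2 Ω →L[ℝ] _).continuous)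
    (continuous_const.inner (WithLp.fstL 2 ℝ _ _ : JetL2 Ω →L[ℝ] _).continuous).neg
  have hsnd : ∀ p : JetL2 Ω, inner ℝ (hΨ.toLp _) p.snd = ∫ x in Ω, ψ x * inner ℝ e (p.snd x) := by
    intro p
    rw [L2.inner_def]
    refine integral_congr_ae ?_
    filter_upwards [hΨ.coeFn_toLp] with x hx
    rw [hx, real_inner_smul_left]
  have hfst : ∀ p : JetL2 Ω,
      inner ℝ (hD.toLp _) p.fst = ∫ x in Ω, fderiv ℝ ψ x e * p.fst x := by
    intro p
    rw [L2.inner_def]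
    refine integral_congr_ae ?_
    filter_upwards [hD.coeFn_toLp] with x hx
    rw [hx, RCLike.inner_apply, conj_trivial, mul_comm]
  have := H10.induction hC (fun φ p h hp => ?_) u
  · have h' : inner ℝ (hΨ.toLp _) (u : JetL2 Ω).snd = - inner ℝ (hD.toLp _) (u : JetL2 Ω).fst := this
    rwa [hsnd, hfst] at h'
  change inner ℝ (hΨ.toLp _) p.snd = - inner ℝ (hD.toLp _) p.fst
  rw [hsnd, hfst]
  -- Each integrand has a factor supported in `Ω`, so the integrals extend to the whole plane, where
  -- there is no boundary term.
  have e1 : ∫ x in Ω, ψ x * inner ℝ e (p.snd x) = ∫ x, ψ x * fderiv ℝ φ x e := by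
    rw [← setIntegral_eq_integral_of_forall_compl_eq_zero (s := Ω)
      (f := fun x => ψ x * fderiv ℝ φ x e)]
    · refine integral_congr_ae ?_
      filter_upwards [hp.2] with x hx
      rw [hx, real_inner_comm, inner_gradient_left]
    · intro x hx
      rw [image_eq_zero_of_notMem_tsupport fun h' => hx (hψ.2.2 h'), zero_mul]
  have e2 : ∫ x in Ω, fderiv ℝ ψ x e * p.fst x = ∫ x, fderiv ℝ ψ x e * φ x := by
    rw [← setIntegral_eq_integral_of_forall_compl_eq_zero (s := Ω)
      (f := fun x => fderiv ℝ ψ x e * φ x)]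
    · refine integral_congr_ae ?_
      filter_upwards [hp.1] with x hx
      rw [hx]
    · intro x hx
      rw [image_eq_zero_of_notMem_tsupport fun h' => hx (h.2.2 h'), mul_zero]
  rw [e1, e2]
  have hdφ : Continuous fun x => fderiv ℝ φ x e :=
    (h.1.continuous_fderiv (by simp)).clm_apply continuous_const
  refine integral_mul_fderiv_eq_neg_fderiv_mul_of_integrable
    ((hdc.mul h.1.continuous).integrable_of_hasCompactSupport h.2.1.mul_left)
    ((hψ.1.continuous.mul hdφ).integrable_of_hasCompactSupport hψ.2.1.mul_right)
    ((hψ.1.continuous.mul h.1.continuous).integrable_of_hasCompactSupport hψ.2.1.mul_right)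
    (fun x _ => hψ.differentiable x) (fun x _ => h.differentiable x)

/-- An element of `H¹₀(Ω)` is determined by its underlying function. -/
lemma grad_eq_zero_of_toL2_eq_zero (hΩ : IsOpen Ω) {u : H10 Ω} (hu : toL2 u = 0) :
    grad u = 0 := by
  have hloc : LocallyIntegrableOn (grad u) Ω :=
    locallyIntegrableOn_of_locallyIntegrable_restrict ((Lp.memLp (grad u)).locallyIntegrable (by norm_num))
  rw [Lp.eq_zero_iff_ae_eq_zero, EventuallyEq, ae_restrict_iff' hΩ.measurableSet]
  refine hΩ.ae_eq_zero_of_integral_contDiff_smul_eq_zero hloc fun ψ hψ hψc hψs => ?_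
  have ht : IsTest Ω ψ := ⟨hψ, hψc, hψs⟩
  rw [← setIntegral_eq_integral_of_forall_compl_eq_zero (s := Ω)]
  swap
  · intro x hx
    rw [image_eq_zero_of_notMem_tsupport fun h' => hx (hψs h'), zero_smul]
  have hint : IntegrableOn (fun x => ψ x • grad u x) Ω :=
    memLp_one_iff_integrable.1 ((Lp.memLp (grad u)).smul (ht.memLp 2))
  refine ext_inner_left ℝ fun e => ?_
  rw [← integral_inner hint e, inner_zero_right]
  simp only [real_inner_smul_right]
  rw [ht.inner_grad_eq e u, neg_eq_zero]
  refine integral_eq_zero_of_ae ?_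
  rw [hu]
  filter_upwards [Lp.coeFn_zero ℝ 2 (volume.restrict Ω)] with x hx
  rw [hx]
  simp

lemma IsWeakSolution.eq_zero_of_grad_eq_zero {u : H10 Ω} {F : HNegOne Ω} (h : IsWeakSolution u F)
    (hu : grad u = 0) : F = 0 := by
  ext v
  rw [← h v, dirichletForm, zero_apply]
  refine integral_eq_zero_of_ae ?_
  rw [hu]
  filter_upwards [Lp.coeFn_zero ℂ 2 (volume.restrict Ω)] with x hx
  rw [hx]
  simp

/-! ### Integrability of the singular functions -/

lemma polarAngle_eq_ite (z : ℂ) :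
    polarAngle z = if z.arg < 0 then z.arg + 2 * Real.pi else z.arg := by
  have h1 := Complex.neg_pi_lt_arg z
  have h2 := Complex.arg_le_pi z
  have h3 := Real.pi_pos
  split_ifs with h
  · rw [polarAngle, ← toIcoMod_add_right, toIcoMod_eq_self]
    constructor <;> linarith
  · rw [polarAngle, toIcoMod_eq_self]
    constructor <;> linarith

lemma measurable_polarAngle : Measurable polarAngle := by
  rw [show polarAngle = _ from funext polarAngle_eq_ite]
  exact Measurable.ite (measurableSet_lt Complex.measurable_arg measurable_const)
    (Complex.measurable_arg.add_const _) Complex.measurable_arg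

lemma isCompact_closedSector (ω R : ℝ) : IsCompact (closedSector ω R) := by
  have : closedSector ω R =
      (fun p : ℝ × ℝ => (p.1 : ℂ) * Complex.exp ((p.2 : ℝ) * Complex.I)) ''
        (Icc 0 R ×ˢ Icc 0 ω) := by
    ext z
    constructor
    · rintro ⟨r, hr, θ, hθ, rfl⟩
      exact ⟨(r, θ), ⟨hr, hθ⟩, rfl⟩
    · rintro ⟨⟨r, θ⟩, ⟨hr, hθ⟩, rfl⟩
      exact ⟨r, hr, θ, hθ, rfl⟩
  rw [this]
  exact (isCompact_Icc.prod isCompact_Icc).image (by fun_prop)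

lemma norm_le_of_mem_closedSector {ω R : ℝ} {z : ℂ} (h : z ∈ closedSector ω R) : ‖z‖ ≤ R := by
  obtain ⟨r, hr, θ, -, rfl⟩ := h
  rw [norm_mul, Complex.norm_exp_ofReal_mul_I, mul_one, Complex.norm_real, Real.norm_eq_abs,
    abs_of_nonneg hr.1]
  exact hr.2

lemma measurable_chi {η : ℝ → ℝ} (hη : Continuous η) (ω R : ℝ) (k : ℕ) :
    Measurable (chi η ω R k) := by
  refine Measurable.ite (isCompact_closedSector ω R).measurableSet ?_ measurable_const
  exact ((hη.measurable.comp measurable_norm).mul (measurable_norm.pow_const _)).mul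
    (Real.measurable_sin.comp (measurable_polarAngle.const_mul _))

lemma exists_abs_chi_le {η : ℝ → ℝ} (hη : Continuous η) (ω R : ℝ) (k : ℕ) :
    ∃ M : ℝ, 0 ≤ M ∧ ∀ z, ‖chi η ω R k z‖ ≤ M * ‖z‖ ^ (-(k * Real.pi / ω)) := by
  -- A bound for `η` on `[0, R]` is enough, since `chi` vanishes off the closed sector.
  obtain ⟨M, hM⟩ := isCompact_Icc.exists_bound_of_continuousOn (s := Icc 0 R) hη.continuousOn
  refine ⟨max M 0, le_max_right _ _, fun z => ?_⟩
  unfold chi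
  split_ifs with h
  · rw [norm_mul, norm_mul, Real.norm_of_nonneg (Real.rpow_nonneg (norm_nonneg z) _)]
    refine (mul_le_of_le_one_right (by positivity) (Real.abs_sin_le_one _)).trans ?_
    gcongr
    exact (hM _ ⟨norm_nonneg z, norm_le_of_mem_closedSector h⟩).trans (le_max_left _ _)
  · rw [norm_zero]
    positivity

/-- In the plane `r^(-s)` is integrable at the origin for `s < 2`; here `s = (kπ/ω) p`. -/
lemma memLp_chi {η : ℝ → ℝ} (hη : Continuous η) (hb : Bornology.IsBounded Ω) (ω R : ℝ) (k : ℕ)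
    {p : ℝ≥0} (hp : 1 ≤ p) (hpk : k * Real.pi / ω * p < 2) :
    MemLp (chi η ω R k) p (volume.restrict Ω) := by
  obtain ⟨M, hM0, hM⟩ := exists_abs_chi_le hη ω R k
  obtain ⟨r, hr⟩ := hb.subset_ball 0
  have hmeas := measurable_chi hη ω R k
  have hp0 : (p : ℝ≥0∞) ≠ 0 := by
    rw [ENNReal.coe_ne_zero]; exact (one_pos.trans_le hp).ne'
  rw [← integrable_norm_rpow_iff hmeas.aestronglyMeasurable hp0 ENNReal.coe_ne_top]
  refine IntegrableOn.mono_set ?_ hr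
  refine integrableOn_ball_of_norm_le_rpow (C := M ^ (p : ℝ)) (α := k * Real.pi / ω * p)
    (by simp [Complex.finrank_real_complex]) (by simpa [Complex.finrank_real_complex] using hpk)
    (ae_of_all _ fun z => ?_) (hmeas.norm.pow_const _).aestronglyMeasurable
  rw [Real.norm_of_nonneg (by positivity), ENNReal.coe_toReal, ← neg_mul,
    Real.rpow_mul (norm_nonneg z), ← Real.mul_rpow hM0 (by positivity)]
  exact Real.rpow_le_rpow (norm_nonneg _) (hM z) p.coe_nonneg

lemma exists_exponent {s : ℝ} (hs : s < 2) : ∃ p : ℝ≥0, 1 < p ∧ s * p < 2 := by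
  have h1 : (1 : ℝ) ≤ max s 1 := le_max_right _ _
  have h2 : max s 1 < 2 := max_lt hs (by norm_num)
  -- With `m = max s 1 < 2`, the choice `p = 4/(m + 2)` works: `p > 1` and `m p < 2` are both
  -- equivalent to `m < 2`.
  have hp : (0 : ℝ) ≤ 4 / (max s 1 + 2) := by positivity
  refine ⟨(4 / (max s 1 + 2)).toNNReal, ?_, ?_⟩
  · rw [Real.one_lt_toNNReal, one_lt_div (by positivity)]
    linarith
  · rw [Real.coe_toNNReal _ hp]
    refine lt_of_le_of_lt (mul_le_mul_of_nonneg_right (le_max_left s 1) hp) ?_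
    rw [mul_div_assoc', div_lt_iff₀ (by positivity)]
    linarith

/-! ### The singular functions near the corner -/

/-- `r^(-a) sin (a θ)` in the upper half plane. -/
def powSin (a : ℝ) (z : ℂ) : ℝ := ‖z‖ ^ (-a) * Real.sin (a * z.arg)

lemma powSin_smul {a t : ℝ} (ht : 0 < t) (z : ℂ) :
    powSin a (t • z) = t ^ (-a) * powSin a z := by
  rw [powSin, powSin, norm_smul, Real.norm_of_nonneg ht.le, Complex.real_smul,
    Complex.arg_real_mul z ht, Real.mul_rpow ht.le (norm_nonneg z), mul_assoc]

lemma continuousAt_powSin {a : ℝ} {z : ℂ} (hz : z ∈ Complex.slitPlane) :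
    ContinuousAt (powSin a) z :=
  (continuousAt_id.norm.rpow_const (Or.inl (by
    simpa using Complex.slitPlane_ne_zero hz))).mul
    (Real.continuous_sin.continuousAt.comp ((Complex.continuousAt_arg hz).const_mul a))

/-- The sector may open beyond `π`, but its part with `arg z > 0` suffices for the blow-up. There
`polarAngle` agrees with `Complex.arg` and the cut-off equals `1`. -/
lemma chi_eq_powSin {η : ℝ → ℝ} {τ R ω : ℝ} (hη : IsCutoff η τ R) (hτ1 : τ < 1) (hR : 0 < R)
    (k : ℕ) {z : ℂ} (hz : ‖z‖ ≤ τ * R) (h0 : 0 < z.arg) (hω : z.arg < ω) :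
    chi η ω R k z = powSin (k * Real.pi / ω) z := by
  have hmem : z ∈ closedSector ω R :=
    ⟨‖z‖, ⟨norm_nonneg z, hz.trans (by nlinarith)⟩, z.arg, ⟨h0.le, hω.le⟩,
      (Complex.norm_mul_exp_arg_mul_I z).symm⟩
  rw [chi, if_pos hmem, hη.2.1 _ (norm_nonneg z) hz, one_mul, powSin, polarAngle_eq_ite,
    if_neg h0.not_gt]

lemma mem_openSector_of_arg {z : ℂ} {ω ρ : ℝ} (hz : ‖z‖ < ρ) (h0 : 0 < z.arg) (hω : z.arg < ω) :
    z ∈ openSector 0 0 ω ρ := by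
  refine ⟨‖z‖, ⟨norm_pos_iff.2 ?_, hz⟩, z.arg, ⟨h0, hω⟩, ?_⟩
  · rintro rfl
    simp at h0
  · rw [zero_add, zero_add, Complex.norm_mul_exp_arg_mul_I]

/-- Under the scaling `z ↦ t z`, `t → 0+`, a combination of the functions `r^(-a i) sin (a i θ)`
behaves like its most singular term. -/
lemma tendsto_sum_powSin {ι : Type*} [Fintype ι] {a : ι → ℝ} {c : ι → ℝ} {k : ι}
    (hk : ∀ i, i ≠ k → c i = 0 ∨ a i < a k) {w : ℂ} (hw : w ∈ Complex.slitPlane) :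
    Tendsto (fun p : ℝ × ℂ => p.1 ^ a k * ∑ i, c i * powSin (a i) (p.1 • p.2))
      (𝓝[>] 0 ×ˢ 𝓝 w) (𝓝 (c k * powSin (a k) w)) := by
  classical
  have hpos : ∀ᶠ p : ℝ × ℂ in 𝓝[>] 0 ×ˢ 𝓝 w, 0 < p.1 :=
    tendsto_fst.eventually self_mem_nhdsWithin
  have hsum : Tendsto (fun p : ℝ × ℂ => ∑ i, c i * (p.1 ^ (a k - a i) * powSin (a i) p.2))
      (𝓝[>] 0 ×ˢ 𝓝 w) (𝓝 (∑ i, if i = k then c k * powSin (a k) w else 0)) := by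
    refine tendsto_finsetSum _ fun i _ => ?_
    have hz : Tendsto (fun p : ℝ × ℂ => powSin (a i) p.2) (𝓝[>] 0 ×ˢ 𝓝 w)
        (𝓝 (powSin (a i) w)) := (continuousAt_powSin hw).tendsto.comp tendsto_snd
    split_ifs with h
    · subst h
      simpa using hz.const_mul (c i)
    · rcases hk i h with h | h
      · simp [h]
      -- By homogeneity the rescaled term `i` carries the factor `t^(a k - a i)`, whose exponent is
      -- positive.
      · have ht : Tendsto (fun t : ℝ => t ^ (a k - a i)) (𝓝[>] 0) (𝓝 0) := by
          have := (Real.continuousAt_rpow_const 0 (a k - a i) (Or.inr (by linarith))).tendsto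
          rw [Real.zero_rpow (by linarith)] at this
          exact this.mono_left nhdsWithin_le_nhds
        simpa using ((ht.comp tendsto_fst).mul hz).const_mul (c i)
  rw [Finset.sum_ite_eq' Finset.univ k, if_pos (Finset.mem_univ k)] at hsum
  refine hsum.congr' ?_
  filter_upwards [hpos] with p hp
  rw [Finset.mul_sum]
  refine Finset.sum_congr rfl fun i _ => ?_
  rw [powSin_smul hp, sub_eq_add_neg, Real.rpow_add hp]
  ring

/-- A function with `|u (t z)| ≥ δ t^(-a)` for `z` near `w` and small `t` is not in `L^(2/a)`. -/
lemma not_memLp_of_scaling {u : ℂ → ℝ} {a δ : ℝ} (ha : 0 < a) (hδ : 0 < δ) {w : ℂ}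
    (h : ∀ᶠ p : ℝ × ℂ in 𝓝[>] 0 ×ˢ 𝓝 w, p.1 • p.2 ∈ Ω ∧ δ ≤ p.1 ^ a * |u (p.1 • p.2)|) :
    ¬ MemLp u (ENNReal.ofReal (2 / a)) (volume.restrict Ω) := by
  intro hu
  obtain ⟨P, hP, Q, hQ, hPQ⟩ := eventually_prod_iff.1 h
  obtain ⟨ε, hε, hball⟩ := Metric.eventually_nhds_iff_ball.1 hQ
  have hq : 0 < 2 / a := by positivity
  have hfin : ∫⁻ x in Ω, ‖u x‖ₑ ^ (2 / a) ≠ ∞ := by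
    have := lintegral_rpow_enorm_lt_top_of_eLpNorm_lt_top (by simpa using hq)
      ENNReal.ofReal_ne_top hu.2
    rw [ENNReal.toReal_ofReal hq.le] at this
    exact this.ne
  -- On `B t`, of area `π t² ε²`, one has `|u|^(2/a) ≥ δ^(2/a) t^(-2)`. The integral over `B t` thus
  -- stays above `π δ^(2/a) ε²` while the area tends to `0`, against absolute continuity of the
  -- integral.
  let B : ℝ → Set ℂ := fun t => Metric.ball (t • w) (t * ε)
  have hmeas : Tendsto (volume.restrict Ω ∘ B) (𝓝[>] 0) (𝓝 0) := by
    have h1 : Tendsto (fun t : ℝ => ENNReal.ofReal (t * ε) ^ 2 * (NNReal.pi : ℝ≥0∞)) (𝓝[>] 0)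
        (𝓝 0) := by
      have : Continuous fun t : ℝ => ENNReal.ofReal (t * ε) ^ 2 * (NNReal.pi : ℝ≥0∞) :=
        ENNReal.continuous_mul_const ENNReal.coe_ne_top |>.comp
          ((ENNReal.continuous_pow 2).comp
            (ENNReal.continuous_ofReal.comp (continuous_id.mul continuous_const)))
      simpa using (this.tendsto 0).mono_left nhdsWithin_le_nhds
    refine tendsto_of_tendsto_of_tendsto_of_le_of_le tendsto_const_nhds h1
      (fun _ => zero_le) fun t => ?_
    rw [← Complex.volume_ball (t • w)]
    exact Measure.restrict_le_self _
  have hlim := tendsto_setLIntegral_zero hfin hmeas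
  have hlow : ∀ᶠ t in 𝓝[>] (0 : ℝ), ENNReal.ofReal (δ ^ (2 / a) * ε ^ 2) * NNReal.pi ≤
      ∫⁻ x in B t, ‖u x‖ₑ ^ (2 / a) ∂(volume.restrict Ω) := by
    filter_upwards [hP, self_mem_nhdsWithin] with t ht ht0
    have ht0 : 0 < t := ht0
    have hmem : ∀ x ∈ B t, x ∈ Ω ∧ δ ≤ t ^ a * |u x| := by
      intro x hx
      have hx' : t • (t⁻¹ • x) = x := smul_inv_smul₀ ht0.ne' x
      have := hPQ ht (hball (t⁻¹ • x) (by
        have hd : dist (t • (t⁻¹ • x)) (t • w) < t * ε := by rwa [hx']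
        rw [dist_smul₀, Real.norm_of_nonneg ht0.le] at hd
        exact lt_of_mul_lt_mul_left hd ht0.le))
      simpa only [hx'] using this
    rw [Measure.restrict_restrict Metric.isOpen_ball.measurableSet,
      inter_eq_left.2 fun x hx => (hmem x hx).1]
    calc ENNReal.ofReal (δ ^ (2 / a) * ε ^ 2) * NNReal.pi
        = ENNReal.ofReal ((t ^ (-a) * δ) ^ (2 / a)) * volume (B t) := by
          rw [Complex.volume_ball, ← ENNReal.ofReal_pow (by positivity), ← mul_assoc,
            ← ENNReal.ofReal_mul (by positivity), Real.mul_rpow (by positivity) hδ.le,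
            ← Real.rpow_mul ht0.le, show -a * (2 / a) = -(2 : ℕ) by field_simp; norm_num,
            Real.rpow_neg ht0.le, Real.rpow_natCast]
          congr 2
          field_simp
      _ = ∫⁻ _ in B t, ENNReal.ofReal ((t ^ (-a) * δ) ^ (2 / a)) := by
          rw [setLIntegral_const]
      _ ≤ _ := by
          refine setLIntegral_mono' Metric.isOpen_ball.measurableSet fun x hx => ?_
          rw [Real.enorm_eq_ofReal_abs, ENNReal.ofReal_rpow_of_nonneg (abs_nonneg _) hq.le]
          gcongr
          rw [Real.rpow_neg ht0.le, inv_mul_le_iff₀ (by positivity)]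
          exact (hmem x hx).2
  have := ge_of_tendsto hlim hlow
  have hpos : 0 < ENNReal.ofReal (δ ^ (2 / a) * ε ^ 2) * (NNReal.pi : ℝ≥0∞) :=
    ENNReal.mul_pos (by simpa using by positivity) (by simpa using NNReal.pi_pos.ne')
  exact hpos.not_ge this

/-- No nontrivial combination of the singular functions is in all `Lᵠ(Ω)`, `q < ∞`. -/
lemma eq_zero_of_memLp_sum_chi {ω τ R : ℝ} (hω : IsInteriorAngleFrom Ω 0 0 ω) (hτ0 : 0 < τ)
    (hτ1 : τ < 1) (hR : 0 < R) {η : ℝ → ℝ} (hη : IsCutoff η τ R) {N : ℕ}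
    (hN : (N : ℝ) < 2 * ω / Real.pi) {c : Fin N → ℝ}
    (hc : ∀ q : ℝ≥0, 1 ≤ q →
      MemLp (fun x => ∑ i : Fin N, c i * chi η ω R (i + 1) x) q (volume.restrict Ω)) :
    ∀ i, c i = 0 := by
  obtain ⟨hω0, hω2, ρ, hρ, hΩρ⟩ := hω
  have hpi := Real.pi_pos
  by_contra! hne
  have hS : (Finset.univ.filter fun i => c i ≠ 0).Nonempty := by
    obtain ⟨i, hi⟩ := hne
    exact ⟨i, by simpa using hi⟩
  obtain ⟨k, hkS, hkmax⟩ := Finset.exists_max_image _ (fun i : Fin N => i) hS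
  have hck : c k ≠ 0 := by simpa using hkS
  let a : Fin N → ℝ := fun i => ((i + 1 : ℕ) : ℝ) * Real.pi / ω
  have ha : 0 < a k := by positivity
  have ha2 : a k < 2 := by
    have h1 : ((k + 1 : ℕ) : ℝ) ≤ N := by exact_mod_cast k.2
    rw [div_lt_iff₀ hω0]
    rw [lt_div_iff₀ hpi] at hN
    nlinarith
  have hk : ∀ i, i ≠ k → c i = 0 ∨ a i < a k := by
    intro i hik
    by_cases h0 : c i = 0
    · exact Or.inl h0
    · right
      have hlt : i < k := lt_of_le_of_ne (hkmax i (by simpa using h0)) hik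
      have : ((i + 1 : ℕ) : ℝ) < ((k + 1 : ℕ) : ℝ) := by exact_mod_cast Nat.succ_lt_succ hlt
      simp only [a]
      gcongr
  -- On this ray `a k * θ = π/2`, so the leading sine equals `1`. Moreover `θ < π` because `ω < 2π`,
  -- which keeps `w` off the branch cut of `arg`.
  let θ : ℝ := ω / (2 * ((k + 1 : ℕ) : ℝ))
  have hk1 : (1 : ℝ) ≤ ((k + 1 : ℕ) : ℝ) := by exact_mod_cast Nat.succ_pos _
  have hθ0 : 0 < θ := by positivity
  have hθω : θ < ω := by
    simp only [θ]
    rw [div_lt_iff₀ (by positivity)]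
    nlinarith
  have hθπ : θ < Real.pi := by
    simp only [θ]
    rw [div_lt_iff₀ (by positivity)]
    nlinarith
  let w : ℂ := Complex.exp (θ * Complex.I)
  have hwn : ‖w‖ = 1 := Complex.norm_exp_ofReal_mul_I θ
  have hwarg : w.arg = θ := by
    simp only [w]
    rw [Complex.arg_exp_mul_I, toIocMod_eq_self]
    constructor <;> linarith
  have hws : w ∈ Complex.slitPlane := by
    rw [Complex.mem_slitPlane_iff_arg, hwarg]
    exact ⟨hθπ.ne, norm_ne_zero_iff.1 (by rw [hwn]; exact one_ne_zero)⟩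
  have hpw : powSin (a k) w = 1 := by
    rw [powSin, hwn, Real.one_rpow, one_mul, hwarg,
      show a k * θ = Real.pi / 2 by simp only [a, θ]; field_simp, Real.sin_pi_div_two]
  have hlim := tendsto_sum_powSin (a := a) (c := c) hk hws
  rw [hpw, mul_one] at hlim
  have hev : ∀ᶠ p : ℝ × ℂ in 𝓝[>] 0 ×ˢ 𝓝 w, p.1 • p.2 ∈ Ω ∧
      |c k| / 2 ≤ p.1 ^ a k * |∑ i : Fin N, c i * chi η ω R (i + 1) (p.1 • p.2)| := by
    have h1 := hlim.abs.eventually (lt_mem_nhds (half_lt_self (abs_pos.2 hck)))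
    have h2 : ∀ᶠ p : ℝ × ℂ in 𝓝[>] 0 ×ˢ 𝓝 w, 0 < p.1 :=
      tendsto_fst.eventually self_mem_nhdsWithin
    have h3 : ∀ᶠ p : ℝ × ℂ in 𝓝[>] 0 ×ˢ 𝓝 w, p.2.arg ∈ Ioo 0 ω :=
      tendsto_snd.eventually ((Complex.continuousAt_arg hws).eventually
        (by rw [hwarg]; exact Ioo_mem_nhds hθ0 hθω))
    have h4 : ∀ᶠ p : ℝ × ℂ in 𝓝[>] 0 ×ˢ 𝓝 w, ‖p.1 • p.2‖ < min ρ (τ * R) := by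
      have : Tendsto (fun p : ℝ × ℂ => ‖p.1 • p.2‖) (𝓝 0 ×ˢ 𝓝 w) (𝓝 ‖(0 : ℝ) • w‖) :=
        (tendsto_fst.smul tendsto_snd).norm
      rw [zero_smul, norm_zero] at this
      exact (this.mono_left (prod_mono nhdsWithin_le_nhds le_rfl)).eventually
        (gt_mem_nhds (lt_min hρ (by positivity)))
    filter_upwards [h1, h2, h3, h4] with p h1 h2 h3 h4
    have harg : (p.1 • p.2).arg = p.2.arg := by rw [Complex.real_smul, Complex.arg_real_mul _ h2]
    rw [lt_min_iff] at h4
    refine ⟨?_, ?_⟩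
    · have : p.1 • p.2 ∈ Ω ∩ Metric.ball 0 ρ := by
        rw [hΩρ]
        exact mem_openSector_of_arg h4.1 (harg ▸ h3.1) (harg ▸ h3.2)
      exact this.1
    · have hchi : ∀ i : Fin N, chi η ω R (i + 1) (p.1 • p.2) = powSin (a i) (p.1 • p.2) :=
        fun i => chi_eq_powSin hη hτ1 hR _ h4.2.le (harg ▸ h3.1) (harg ▸ h3.2)
      simp only [hchi]
      rw [abs_mul, abs_of_pos (Real.rpow_pos_of_pos h2 _)] at h1
      exact h1.le
  -- The critical exponent `2 / a k` is an admissible `q`: it is at least `1` because `a k < 2`.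
  refine not_memLp_of_scaling ha (by positivity) hev (hc (2 / a k).toNNReal ?_)
  rw [Real.one_le_toNNReal, one_le_div ha]
  exact ha2.le

/-! ### The main theorem -/

/-- `χ_i + ζ` belongs to `H⁻¹(Ω)`. -/
lemma exists_isFunction_chi_add {ω R : ℝ} (hb : Bornology.IsBounded Ω) {η : ℝ → ℝ}
    (hη : Continuous η) {k : ℕ} (hk : k * Real.pi / ω < 2) (ζ : H10 Ω) :
    IntegrableOn (fun x => chi η ω R k x + toL2 ζ x) Ω ∧
      ∃ F : HNegOne Ω, F.IsFunction (fun x => chi η ω R k x + toL2 ζ x) := by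
  have : IsFiniteMeasure (volume.restrict Ω) := ⟨by simpa using hb.measure_lt_top⟩
  obtain ⟨p, hp1, hpk⟩ := exists_exponent hk
  have hmem : MemLp (fun x => chi η ω R k x + toL2 ζ x) p (volume.restrict Ω) :=
    (memLp_chi hη hb ω R k hp1.le hpk).add (memLp_toL2 hp1.le hb ζ)
  obtain ⟨F, hF⟩ := exists_functional hp1 hb hmem
  exact ⟨hmem.integrable (by exact_mod_cast hp1.le), F, HNegOne.isFunction_of_forall hF⟩

lemma toL2_sum_smul {ι : Type*} (s : Finset ι) (c : ι → ℝ) (σ : ι → H10 Ω) :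
    toL2 (∑ i ∈ s, c i • σ i) = ∑ i ∈ s, c i • toL2 (σ i) :=
  (map_sum ((WithLp.fstL 2 ℝ _ _ : JetL2 Ω →L[ℝ] _).toLinearMap ∘ₗ (H10 Ω).subtype) _ s).trans
    (Finset.sum_congr rfl fun _ _ => map_smul _ _ _)

lemma grad_sum_smul {ι : Type*} (s : Finset ι) (c : ι → ℝ) (σ : ι → H10 Ω) :
    grad (∑ i ∈ s, c i • σ i) = ∑ i ∈ s, c i • grad (σ i) :=
  (map_sum ((WithLp.sndL 2 ℝ _ _ : JetL2 Ω →L[ℝ] _).toLinearMap ∘ₗ (H10 Ω).subtype) _ s).trans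
    (Finset.sum_congr rfl fun _ _ => map_smul _ _ _)

lemma dirichletForm_eq_inner (u v : H10 Ω) : dirichletForm u v = inner ℝ (grad u) (grad v) :=
  (L2.inner_def _ _).symm

lemma IsWeakSolution.sum {ι : Type*} (s : Finset ι) {σ : ι → H10 Ω} {F : ι → HNegOne Ω}
    (h : ∀ i, IsWeakSolution (σ i) (F i)) (c : ι → ℝ) :
    IsWeakSolution (∑ i ∈ s, c i • σ i) (∑ i ∈ s, c i • F i) := by
  intro v
  rw [dirichletForm_eq_inner, grad_sum_smul, sum_inner, sum_apply]
  refine Finset.sum_congr rfl fun i _ => ?_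
  rw [real_inner_smul_left, ← dirichletForm_eq_inner, h i v, smul_apply, smul_eq_mul]

end CornerSingular
end
open CornerSingular

/-! The independence rests on the behaviour of `χ_i` at the corner: no nontrivial combination of
the `χ_i` lies in every `Lᵠ(Ω)`, `q < ∞`, while every element of `H¹₀(Ω)`, in particular a
combination of the `ζ_i`, does. -/

theorem mainTheorem4
    {n : ℕ} (P : Polygon ℂ n) (Ω : Set ℂ) (hΩ : CornerSingular.IsPolygonalDomain P Ω)
    -- the origin is a vertex with interior angle `ω`, spanned by `θ = 0` and `θ = ω`
    (ω : ℝ) (hQ : (0 : ℂ) ∈ Set.range P.vertices)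
    (hω : CornerSingular.IsInteriorAngleFrom Ω 0 0 ω)
    -- `ω` is the largest interior angle, and all other ones are at most `π / 2`
    (hmax : ∀ (j : Fin n) (α : ℝ), P j ≠ 0 → CornerSingular.IsInteriorAngle Ω (P j) α →
      α ≤ ω ∧ α ≤ Real.pi / 2)
    (τ R : ℝ) (hτ0 : 0 < τ) (hτ1 : τ < 1) (hR : 0 < R)
    (hK : CornerSingular.closedSector ω R ⊆ closure Ω)
    (η : ℝ → ℝ) (hη : CornerSingular.IsCutoff η τ R)
    -- `N` is the largest integer below `2 ω / π`
    (N : ℕ) (hN : IsGreatest {m : ℕ | (m : ℝ) < 2 * ω / Real.pi} N)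
    (ζ : Fin N → CornerSingular.H10 Ω)
    (hζ : ∀ i : Fin N, CornerSingular.IsWeakSolutionFun (ζ i)
      (Laplacian.laplacian (CornerSingular.chi η ω R (i + 1)))) :
    -- `χ_i + ζ_i` lies in `H⁻¹(Ω)`, where it is denoted by `ξ i`
    ∃ ξ : Fin N → CornerSingular.HNegOne Ω,
      (∀ i : Fin N, (ξ i).IsFunction
        (fun x => CornerSingular.chi η ω R (i + 1) x + CornerSingular.toL2 (ζ i) x)) ∧
      LinearIndependent ℝ ξ ∧
      ∀ σ : Fin N → CornerSingular.H10 Ω,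
        (∀ i : Fin N, CornerSingular.IsWeakSolution (σ i) (ξ i)) →
          LinearIndependent ℝ (fun i => CornerSingular.toL2 (σ i)) ∧
          LinearIndependent ℝ (fun i => CornerSingular.grad (σ i)) := by
  have hNmem : (N : ℝ) < 2 * ω / Real.pi := hN.1
  have hb := hΩ.isBounded
  have hηc : Continuous η := hη.1.continuous
  -- The index `i : Fin N` stands for `i + 1`; the bound `N < 2ω/π` says exactly that the strongest
  -- exponent `Nπ/ω` is below `2`.
  have hexp : ∀ i : Fin N, ((i + 1 : ℕ) : ℝ) * Real.pi / ω < 2 := by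
    intro i
    have h1 : ((i + 1 : ℕ) : ℝ) ≤ N := by exact_mod_cast i.2
    rw [div_lt_iff₀ hω.1]
    exact (mul_le_mul_of_nonneg_right h1 Real.pi_pos.le).trans_lt
      ((lt_div_iff₀ Real.pi_pos).1 hNmem)
  have hint := fun i => (exists_isFunction_chi_add (R := R) hb hηc (hexp i) (ζ i)).1
  choose ξ hξ using fun i => (exists_isFunction_chi_add (R := R) hb hηc (hexp i) (ζ i)).2
  have hind : ∀ c : Fin N → ℝ, ∑ i, c i • ξ i = 0 → ∀ i, c i = 0 := by
    intro c hc
    have h1 := HNegOne.IsFunction.sum Finset.univ hξ c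
    rw [hc] at h1
    have h2 := h1.ae_eq_zero hΩ.isOpen
      (IntegrableOn.locallyIntegrableOn
        (integrable_finsetSum _ fun i _ => (hint i).const_mul (c i)))
    refine eq_zero_of_memLp_sum_chi hω hτ0 hτ1 hR hη hNmem fun q hq => ?_
    -- Almost everywhere the combination of the `χ_i` is minus that of the `ζ_i`, which the Sobolev
    -- embedding puts in `Lᵠ`.
    have h3 : MemLp (fun x => -∑ i, c i * toL2 (ζ i) x) q (volume.restrict Ω) :=
      (memLp_finsetSum _ fun i _ => (memLp_toL2 hq hb (ζ i)).const_mul (c i)).neg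
    refine (memLp_congr_ae ?_).1 h3
    filter_upwards [h2] with x hx
    simp only [mul_add, Finset.sum_add_distrib, Pi.zero_apply] at hx
    linarith
  refine ⟨ξ, hξ, Fintype.linearIndependent_iff.2 hind, fun σ hσ => ?_⟩
  have hgrad : ∀ c : Fin N → ℝ, grad (∑ i, c i • σ i) = 0 → ∀ i, c i = 0 := fun c hc =>
    hind c ((IsWeakSolution.sum Finset.univ hσ c).eq_zero_of_grad_eq_zero hc)
  refine ⟨Fintype.linearIndependent_iff.2 fun c hc => hgrad c ?_,
    Fintype.linearIndependent_iff.2 fun c hc => hgrad c ?_⟩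
  · exact grad_eq_zero_of_toL2_eq_zero hΩ.isOpen ((toL2_sum_smul _ c σ).trans hc)
  · exact (grad_sum_smul _ c σ).trans hc
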